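/- All graphs are finite, simple and undirected. For a graph $F$ and a set $S\subseteq V(F)$ with $|S|\ge 2$, an $S$-Steiner tree is a subgraph of $F$ that is a tree and whose vertex set contains $S$; let $\lambda(S)$ be the maximum number of pairwise edge-disjoint $S$-Steiner trees in $F$. The generalized $3$-edge-connectivity of $F$ is $\lambda_3(F)=\min\{\lambda(S): S\subseteq V(F),\ |S|=3\}$; we put $\lambda_3(F)=0$ if $F$ is disconnected or has fewer than three vertices. The lexicographic product $G\circ H$ has vertex set $V(G)\times V(H)$, and $(u,v)$, $(u',v')$ are adjacent if and only if $uu'\in E(G)$, or $u=u'$ and $vv'\in E(H)$. Theorem. Let $G$ and $H$ be graphs with at least two vertices each, and let $G$ be connected. Then $$\lambda_3(G\circ H)\ \ge\ \lambda_3(H)+\lambda_3(G)\,|V(H)|.$$ Moreover, the bound is sharp: equality holds for $G=P_m$ and $H=P_n$ for all $m,n\ge 3$, where $P_k$ denotes the path on $k$ vertices. -/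

import Mathlib

/-- The lexicographic product `G ∘ H`: vertices `(u, v)` and `(u', v')` are adjacent iff
`u u'` is an edge of `G`, or `u = u'` and `v v'` is an edge of `H`. -/
def SimpleGraph.lexProduct {V W : Type*} (G : SimpleGraph V) (H : SimpleGraph W) :
    SimpleGraph (V × W) where
  Adj p q := G.Adj p.1 q.1 ∨ (p.1 = q.1 ∧ H.Adj p.2 q.2)
  symm := ⟨fun _ _ h => h.elim (fun h => Or.inl h.symm) (fun h => Or.inr ⟨h.1.symm, h.2.symm⟩)⟩
  loopless := ⟨fun _ h => h.elim (fun h => h.ne rfl) (fun h => h.2.ne rfl)⟩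

/-- `T` is an `S`-Steiner tree of `G`: a subgraph of `G` that is a tree and contains `S`. -/
def SimpleGraph.IsSteinerTree {V : Type*} (G : SimpleGraph V) (S : Finset V)
    (T : G.Subgraph) : Prop :=
  T.coe.IsTree ∧ ∀ v ∈ S, v ∈ T.verts

/-- `G` contains `l` pairwise edge-disjoint `S`-Steiner trees. -/
def SimpleGraph.HasSteinerPacking {V : Type*} (G : SimpleGraph V) (S : Finset V)
    (l : ℕ) : Prop :=
  ∃ T : Fin l → G.Subgraph, (∀ i, G.IsSteinerTree S (T i)) ∧
    ∀ i j, i ≠ j → Disjoint (T i).edgeSet (T j).edgeSet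

/-- `λ(S)`: the maximum number of pairwise edge-disjoint `S`-Steiner trees of `G`
(for a finite graph and `S` with at least two vertices, the supremum is a maximum, because
every such tree has an edge). -/
noncomputable def SimpleGraph.steinerPackingNumber {V : Type*} (G : SimpleGraph V)
    (S : Finset V) : ℕ :=
  sSup {l : ℕ | G.HasSteinerPacking S l}

open Classical in
/-- The generalized `k`-edge-connectivity `λ_k(G)`: the minimum of `λ(S)` over all sets `S` of
`k` vertices, and `0` if `G` is disconnected. If `G` has fewer than `k` vertices, there is no
such `S` and the value is `0`. -/
noncomputable def SimpleGraph.genEdgeConnectivity {V : Type*} (k : ℕ) (G : SimpleGraph V) : ℕ :=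
  if G.Connected then
    sInf {m : ℕ | ∃ S : Finset V, S.card = k ∧ m = G.steinerPackingNumber S}
  else 0

/-!
For the lower bound it suffices to find edge-disjoint connected subgraphs containing a given set `S`
of three vertices, as a Steiner tree can be chosen in each (`exists_isSteinerTree`). Write `n = |W|`
and call `{s} × W` the layer of `s`.

`λ₃(G)` provides edge-disjoint trees `T` in `G` that link the first coordinates of `S`, and `λ₃(H)`
provides `k = λ₃(H)` edge-disjoint trees `A i` in `H` that link the second coordinates. Along each `T`,
the edges between the layers suffice for `n` subgraphs. Moreover, they can be chosen so sparsely
that, along one `T`, there remains an edge joining copies of `A i` in adjacent layers for every `i`;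
the copies of `A i` in all layers, joined by these edges, form `k` additional subgraphs. This is the
content of `LinkData.packsAlong`. The subgraphs are described by colouring the complete bipartite
graphs between adjacent layers, separately for each edge of `T`.

* If `S` has one vertex `(s, p s)` in each of three layers (`LinkData.packsAlong_section`), an edge
  `s t` of `T` is replaced in the `j`-th subgraph by the walk `(s, p s), (t, j), (s, π j), (t, p t)`,
  where `π` is a permutation of `W` with `π (p t) = p s`.
* If two vertices of `S` lie in the layer of `u` and one in the layer of `w`, a single edge `u w` would
  not be enough for `n` subgraphs. Since `T` links three vertices of `G`, it has another edge at `u`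
  (`LinkData.packsAlong_of_adj_left`) or at `w` (`LinkData.packsAlong_of_adj_right`).
* If `S` lies in one layer (`LinkData.packsAlong_layer`), the stars centred at the vertices of an
  adjacent layer and the `A i` themselves do.

That enough edges remain for the `A i` comes down to `k ≤ n - 2` if `k > 0`
(`exists_injective_adj`). If `λ₃(G) = 0`, connectedness of `G` alone allows the copies of the `A i` to
be joined (`LinkData.hasSteinerPacking`).

For paths, equality holds since `λ₃` is at most the minimum degree (`genEdgeConnectivity_le_card`),
which is `1` for a path and at most `n + 1` for the product.
-/

namespace SimpleGraph

variable {V W ι C : Type*}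

/-! ### Steiner trees and edge-disjoint subgraphs -/

/-- `K` links `S` if any two vertices of `S` are joined by a walk in `K`. -/
def Links (K : SimpleGraph V) (S : Set V) : Prop :=
  ∀ x ∈ S, ∀ y ∈ S, K.Reachable x y

/-- The graphs `F i` are pairwise edge-disjoint. -/
def EdgeDisjoint {ι : Type*} (F : ι → SimpleGraph V) : Prop :=
  ∀ i j x y, (F i).Adj x y → (F j).Adj x y → i = j

lemma Links.mono {K L : SimpleGraph V} {S : Set V} (h : K.Links S) (hKL : K ≤ L) : L.Links S :=
  fun x hx y hy => (h x hx y hy).mono hKL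

lemma Links.exists_adj {K : SimpleGraph V} {S : Set V} (h : K.Links S) {x y : V} (hx : x ∈ S)
    (hy : y ∈ S) (hxy : x ≠ y) : ∃ z, K.Adj x z := by
  obtain ⟨p⟩ := h x hx y hy
  cases p with
  | nil => exact absurd rfl hxy
  | cons h _ => exact ⟨_, h⟩

/-- If `x` lies in `U` and `y` does not, then a connection from `x` to `y` leaves `U`. -/
lemma Reachable.exists_adj_boundary {K : SimpleGraph V} {x y : V} (h : K.Reachable x y)
    (U : Set V) (hx : x ∈ U) (hy : y ∉ U) : ∃ a ∈ U, ∃ b ∉ U, K.Adj a b := by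
  obtain ⟨p⟩ := h
  obtain ⟨d, -, h1, h2⟩ := p.exists_boundary_dart U hx hy
  exact ⟨_, h1, _, h2, d.adj⟩

lemma IsSteinerTree.links {G : SimpleGraph V} {S : Finset V} {T : G.Subgraph}
    (h : G.IsSteinerTree S T) : T.spanningCoe.Links (S : Set V) := by
  intro x hx y hy
  have := h.1.connected.preconnected ⟨x, h.2 x hx⟩ ⟨y, h.2 y hy⟩
  exact this.map (⟨Subtype.val, fun h => h⟩ : T.coe →g T.spanningCoe)

lemma exists_isSteinerTree {G K : SimpleGraph V} (hK : K ≤ G) {S : Finset V} (hS : S.Nonempty)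
    (h : K.Links (S : Set V)) :
    ∃ T : G.Subgraph, G.IsSteinerTree S T ∧ ∀ x y, T.Adj x y → K.Adj x y := by
  obtain ⟨x, hx⟩ := hS
  let C := K.connectedComponentMk x
  obtain ⟨T, hT, hT'⟩ := C.connected_toSimpleGraph.exists_isTree_le
  let T' : G.Subgraph :=
    { verts := C.supp
      Adj := fun a b => ∃ (ha : a ∈ C.supp) (hb : b ∈ C.supp), T.Adj ⟨a, ha⟩ ⟨b, hb⟩
      adj_sub := fun ⟨_, _, h⟩ => hK (hT h)
      edge_vert := fun ⟨ha, _, _⟩ => ha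
      symm := ⟨fun _ _ ⟨ha, hb, h⟩ => ⟨hb, ha, h.symm⟩⟩ }
  refine ⟨T', ⟨?_, ?_⟩, ?_⟩
  · have : T'.coe = T := by
      ext a b
      exact ⟨fun ⟨_, _, h⟩ => h, fun h => ⟨a.2, b.2, h⟩⟩
    rw [this]; exact hT'
  · intro v hv
    exact ConnectedComponent.sound (h v hv x hx)
  · rintro a b ⟨_, _, h⟩
    exact hT h

lemma hasSteinerPacking_of_edgeDisjoint {ι : Type*} [Fintype ι] {G : SimpleGraph V}
    {S : Finset V} (hS : S.Nonempty) (F : ι → SimpleGraph V) (hle : ∀ i, F i ≤ G)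
    (hF : EdgeDisjoint F) (hl : ∀ i, (F i).Links (S : Set V)) :
    G.HasSteinerPacking S (Fintype.card ι) := by
  choose T hT hTF using fun i => exists_isSteinerTree (hle i) hS (hl i)
  let e := (Fintype.equivFin ι).symm
  refine ⟨fun i => T (e i), fun i => hT _, fun i j hij => ?_⟩
  rw [Set.disjoint_left]
  intro z
  induction z with | _ x y =>
  intro h1 h2
  exact hij (e.injective (hF _ _ x y (hTF _ _ _ h1) (hTF _ _ _ h2)))

lemma HasSteinerPacking.exists_edgeDisjoint {G : SimpleGraph V} {S : Finset V} {l : ℕ}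
    (h : G.HasSteinerPacking S l) : ∃ F : Fin l → SimpleGraph V,
      (∀ i, F i ≤ G) ∧ EdgeDisjoint F ∧ ∀ i, (F i).Links (S : Set V) := by
  obtain ⟨T, hT, hd⟩ := h
  refine ⟨fun i => (T i).spanningCoe, fun i => (T i).spanningCoe_le, ?_, fun i => (hT i).links⟩
  intro i j x y h1 h2
  by_contra hij
  exact (Set.disjoint_left.1 (hd i j hij)) (show s(x, y) ∈ (T i).edgeSet from h1) h2

lemma HasSteinerPacking.mono {G : SimpleGraph V} {S : Finset V} {l k : ℕ}
    (h : G.HasSteinerPacking S l) (hk : k ≤ l) : G.HasSteinerPacking S k := by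
  obtain ⟨T, hT, hd⟩ := h
  exact ⟨fun i => T (Fin.castLE hk i), fun i => hT _,
    fun i j hij => hd _ _ fun h => hij (Fin.castLE_injective hk h)⟩

/-- Each tree of a packing uses its own edge at a given terminal, so the size of the packing is
at most the degree of that terminal. -/
lemma HasSteinerPacking.le_card {G : SimpleGraph V} {S : Finset V} {l : ℕ}
    (h : G.HasSteinerPacking S l) {v : V} (hv : v ∈ S) (hS : 2 ≤ S.card) (N : Finset V)
    (hN : ∀ u, G.Adj v u → u ∈ N) : l ≤ N.card := by
  obtain ⟨F, hle, hd, hl⟩ := h.exists_edgeDisjoint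
  obtain ⟨w, hw, hwv⟩ := Finset.exists_mem_ne (by omega : 1 < S.card) v
  choose f hf using fun i => (hl i).exists_adj hv hw hwv.symm
  have := Finset.card_le_card_of_injOn (s := Finset.univ) (t := N) f
    (fun i _ => hN _ (hle i (hf i)))
    (fun i _ j _ hij => hd i j v (f i) (hf i) (by rw [show f i = f j from hij]; exact hf j))
  simpa using this

lemma bddAbove_hasSteinerPacking [Fintype V] {G : SimpleGraph V} {S : Finset V}
    (hS : 2 ≤ S.card) : BddAbove {l : ℕ | G.HasSteinerPacking S l} := by
  obtain ⟨v, hv⟩ := Finset.card_pos.1 (by omega : 0 < S.card)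
  exact ⟨_, fun l hl => HasSteinerPacking.le_card hl hv hS Finset.univ fun u _ =>
    Finset.mem_univ u⟩

lemma hasSteinerPacking_steinerPackingNumber [Fintype V] {G : SimpleGraph V} {S : Finset V}
    (hS : 2 ≤ S.card) : G.HasSteinerPacking S (G.steinerPackingNumber S) :=
  Nat.sSup_mem (s := {l : ℕ | G.HasSteinerPacking S l})
    ⟨0, fun i => i.elim0, fun i => i.elim0, fun i => i.elim0⟩ (bddAbove_hasSteinerPacking hS)

lemma hasSteinerPacking_genEdgeConnectivity [Fintype V] {G : SimpleGraph V} {S : Finset V}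
    (hS : S.card = 3) : G.HasSteinerPacking S (G.genEdgeConnectivity 3) := by
  refine (hasSteinerPacking_steinerPackingNumber (by omega)).mono ?_
  unfold genEdgeConnectivity
  split_ifs
  · exact Nat.sInf_le ⟨S, hS, rfl⟩
  · exact Nat.zero_le _

lemma three_le_card_of_genEdgeConnectivity_pos [Fintype V] {G : SimpleGraph V}
    (h : 0 < G.genEdgeConnectivity 3) : 3 ≤ Fintype.card V := by
  unfold genEdgeConnectivity at h
  split_ifs at h
  · obtain ⟨m, S, hS, -⟩ := Nat.nonempty_of_pos_sInf h
    exact hS ▸ S.card_le_univ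
  · simp at h

lemma le_genEdgeConnectivity [Fintype V] {G : SimpleGraph V} (hG : G.Connected)
    (hV : 3 ≤ Fintype.card V) {l : ℕ}
    (h : ∀ S : Finset V, S.card = 3 → G.HasSteinerPacking S l) :
    l ≤ G.genEdgeConnectivity 3 := by
  unfold genEdgeConnectivity
  rw [if_pos hG]
  obtain ⟨S₀, -, hS₀⟩ := Finset.exists_subset_card_eq (s := (Finset.univ : Finset V)) hV
  refine le_csInf ⟨_, S₀, hS₀, rfl⟩ ?_
  rintro _ ⟨S, hS, rfl⟩
  exact le_csSup (bddAbove_hasSteinerPacking (by omega)) (h S hS)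

lemma genEdgeConnectivity_le_card [Fintype V] {G : SimpleGraph V}
    (hV : 3 ≤ Fintype.card V) (v : V) (N : Finset V) (hN : ∀ u, G.Adj v u → u ∈ N) :
    G.genEdgeConnectivity 3 ≤ N.card := by
  obtain ⟨S, hvS, -, hS⟩ := Finset.exists_subsuperset_card_eq
    (Finset.subset_univ {v}) (by simp : _ ≤ 3) hV
  exact (hasSteinerPacking_genEdgeConnectivity hS).le_card (hvS (by simp)) (by omega) N hN

lemma one_le_genEdgeConnectivity [Fintype V] {G : SimpleGraph V} (hG : G.Connected)
    (hV : 3 ≤ Fintype.card V) : 1 ≤ G.genEdgeConnectivity 3 :=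
  le_genEdgeConnectivity hG hV fun _ hS =>
    hasSteinerPacking_of_edgeDisjoint (Finset.card_pos.1 (by omega)) (fun _ : Unit => G)
      (fun _ => le_rfl) (fun _ _ _ _ _ _ => rfl) fun _ x _ y _ => hG.preconnected x y

/-! ### Edge-disjoint graphs linking three vertices of the second factor -/

/-- Edge-disjoint graphs `A i` linking three common vertices are attached to a terminal `q` by
distinct edges `q β(i)`, and these do not exhaust the other vertices: either `d` is missed, or
the `A i` containing the edge `q d` has a second edge at `q` or at `d`, where every other `A j`
has an edge too, so that there are at most `|W| - 2` indices. -/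
lemma exists_injective_adj [Fintype W] [Fintype ι] {A : ι → SimpleGraph W} (hA : EdgeDisjoint A)
    {q d e : W} (hqd : q ≠ d) (hqe : q ≠ e) (hde : d ≠ e)
    (hl : ∀ i, (A i).Links {q, d, e}) :
    ∃ β : ι → W, Function.Injective β ∧ (∀ i, (A i).Adj q (β i)) ∧
      ∃ c, c ≠ q ∧ ∀ i, β i ≠ c := by
  classical
  choose β hβ using fun i => (hl i).exists_adj (by simp) (by simp) hqd
  have hinj : Function.Injective β := fun i j hij => hA i j q (β i) (hβ i) (hij ▸ hβ j)
  refine ⟨β, hinj, hβ, ?_⟩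
  by_cases hd : ∃ i, β i = d
  swap
  · exact ⟨d, hqd.symm, fun i hi => hd ⟨i, hi⟩⟩
  obtain ⟨i, hi⟩ := hd
  have hiqd : (A i).Adj q d := hi ▸ hβ i
  have hbranch : ∃ v ∈ ({q, d, e} : Set W), (∃ z ∈ ({q, d, e} : Set W), v ≠ z) ∧
      ∃ b₁ b₂, b₁ ≠ b₂ ∧ (A i).Adj v b₁ ∧ (A i).Adj v b₂ := by
    obtain ⟨a, ha, b, hb, hab⟩ := (hl i q (by simp) e (by simp)).exists_adj_boundary {q, d}
      (by simp) (by simp [hqe.symm, hde.symm])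
    simp only [Set.mem_insert_iff, Set.mem_singleton_iff, not_or] at ha hb
    rcases ha with rfl | rfl
    · exact ⟨a, by simp, ⟨d, by simp, hqd⟩, d, b, fun h => hb.2 h.symm, hiqd, hab⟩
    · exact ⟨a, by simp, ⟨q, by simp, hqd.symm⟩, q, b, fun h => hb.1 h.symm, hiqd.symm, hab⟩
  obtain ⟨v, hv, ⟨z, hz, hvz⟩, b₁, b₂, hb, hb₁, hb₂⟩ := hbranch
  choose γ hγ using fun i => (hl i).exists_adj hv hz hvz
  by_contra! hcon
  have hle : Fintype.card W ≤ Fintype.card (Option ι) := by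
    refine Fintype.card_le_of_surjective (fun o => o.elim q β) fun c => ?_
    by_cases hc : c = q
    · exact ⟨none, hc.symm⟩
    · obtain ⟨j, hj⟩ := hcon c hc
      exact ⟨some j, hj⟩
  let γ' : ι → W := fun j => if j = i then b₂ else γ j
  have hγ' : ∀ j, (A j).Adj v (γ' j) := by
    intro j
    by_cases hj : j = i
    · subst hj; simpa [γ'] using hb₂
    · simpa [γ', hj] using hγ j
  have hγb : ∀ j, γ' j ≠ b₁ := by
    intro j hj
    have : j = i := hA j i v b₁ (hj ▸ hγ' j) hb₁
    subst this
    exact hb (by simpa [γ'] using hj.symm)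
  have hlt : Fintype.card (Option (Option ι)) ≤ Fintype.card W := by
    refine Fintype.card_le_of_injective
      (fun o : Option (Option ι) => o.elim v fun o' => o'.elim b₁ γ') ?_
    rintro (_ | _ | j) (_ | _ | k) h <;> simp only [Option.elim] at h
    · rfl
    · exact absurd h hb₁.ne
    · exact absurd h (hγ' k).ne
    · exact absurd h.symm hb₁.ne
    · rfl
    · exact absurd h.symm (hγb k)
    · exact absurd h.symm (hγ' j).ne
    · exact absurd h (hγb j)
    · rw [hA j k v (γ' j) (hγ' j) (h ▸ hγ' k)]
  simp only [Fintype.card_option] at hle hlt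
  omega

/-- Edge-disjoint graphs `A i` that link `R`, with the properties of `R` used to connect a copy of
`A i` in one layer to a copy in another: a third element of `R` is available, and every `A i` meets
a vertex `β i` of its own. The edges `(s, π j) (t, j)` between two layers are going to be used for a
permutation `π`; that `π (β i) ≠ c` means that the edges `(s, c) (t, β i)` are not among them. -/
structure LinkData (A : ι → SimpleGraph W) (R : Set W) : Prop where
  edgeDisjoint : EdgeDisjoint A
  links : ∀ i, (A i).Links R
  exists_third : Nonempty ι → ∀ a b, ∃ c ∈ R, c ≠ a ∧ c ≠ b
  exists_attach : ∀ q ∈ R, ∃ β : ι → W, Function.Injective β ∧ (∀ i, (A i).Reachable q (β i)) ∧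
    (∀ i, β i ≠ q) ∧ ∀ p c, c ≠ p → ∃ π : Equiv.Perm W, π q = p ∧ ∀ i, π (β i) ≠ c

lemma LinkData.of_isEmpty [IsEmpty ι] (A : ι → SimpleGraph W) (R : Set W) : LinkData A R where
  edgeDisjoint i := isEmptyElim i
  links i := isEmptyElim i
  exists_third h := isEmptyElim h.some
  exists_attach q _ := by
    classical
    exact ⟨isEmptyElim, fun i => isEmptyElim i, fun i => isEmptyElim i, fun i => isEmptyElim i,
      fun p _ _ => ⟨Equiv.swap q p, by simp, fun i => isEmptyElim i⟩⟩

lemma LinkData.of_links [Fintype W] [Fintype ι] {A : ι → SimpleGraph W} (hA : EdgeDisjoint A)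
    {R : Finset W} (hR : R.card = 3) (hl : ∀ i, (A i).Links (R : Set W)) :
    LinkData A (R : Set W) where
  edgeDisjoint := hA
  links := hl
  exists_third _ a b := by
    classical
    obtain ⟨c, hc, hc'⟩ := Finset.exists_mem_notMem_of_card_lt_card
      (s := {a, b}) (t := R) (by have := Finset.card_le_two (a := a) (b := b); omega)
    simp only [Finset.mem_insert, Finset.mem_singleton, not_or] at hc'
    exact ⟨c, hc, hc'⟩
  exists_attach q hq := by
    classical
    obtain ⟨d, e, hde, hR'⟩ : ∃ d e, d ≠ e ∧ R.erase q = {d, e} :=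
      Finset.card_eq_two.1 (by rw [Finset.card_erase_of_mem hq, hR])
    have hd : d ∈ R.erase q := by rw [hR']; simp
    have he : e ∈ R.erase q := by rw [hR']; simp
    rw [Finset.mem_erase] at hd he
    have hsub : ({q, d, e} : Set W) ⊆ R := by
      rintro x (rfl | rfl | rfl)
      exacts [hq, hd.2, he.2]
    obtain ⟨β, hβ, hadj, c', hc', hβc⟩ := exists_injective_adj hA hd.1.symm he.1.symm hde
      fun i x hx y hy => hl i x (hsub hx) y (hsub hy)
    refine ⟨β, hβ, fun i => (hadj i).reachable, fun i => (hadj i).ne', fun p c hcp => ?_⟩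
    have hr : Equiv.swap q p c' ≠ p := fun h =>
      hc' ((Equiv.swap q p).injective (h.trans (Equiv.swap_apply_left q p).symm))
    refine ⟨(Equiv.swap q p).trans (Equiv.swap (Equiv.swap q p c') c), ?_, fun i hi => ?_⟩
    · simp [Equiv.swap_apply_of_ne_of_ne hr.symm hcp.symm]
    · refine hβc i (((Equiv.swap q p).trans
        (Equiv.swap (Equiv.swap q p c') c)).injective (hi.trans ?_))
      simp

/-! ### Distributing the edges between layers -/

/-- The edges between two layers can be given colours in such a way that, if `F x` contains the
edges of colour `x` between the layers of `s` and `t`, then `Q F s t` holds. -/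
def Colourable (Q : (C → SimpleGraph (V × W)) → V → V → Prop) (s t : V) : Prop :=
  ∃ g : W → W → Option C, ∀ F : C → SimpleGraph (V × W),
    (∀ x a b, g a b = some x → (F x).Adj (s, a) (t, b)) → Q F s t

lemma Colourable.symm {Q : (C → SimpleGraph (V × W)) → V → V → Prop}
    (hQ : ∀ F s t, Q F s t → Q F t s) {s t : V} (h : Colourable Q s t) : Colourable Q t s := by
  obtain ⟨g, hg⟩ := h
  exact ⟨fun a b => g b a, fun F hF => hQ _ _ _ (hg F fun x a b h => (hF x b a h).symm)⟩

/-- Colourings chosen separately for each edge of `T` define edge-disjoint subgraphs of the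
lexicographic product of `T` with an edgeless graph. -/
lemma exists_edgeDisjoint_of_colourable (T : SimpleGraph V)
    {Q : (C → SimpleGraph (V × W)) → V → V → Prop} (hQ : ∀ F s t, Q F s t → Q F t s)
    (h : ∀ s t, T.Adj s t → Colourable Q s t) :
    ∃ F : C → SimpleGraph (V × W), (∀ x, F x ≤ T.lexProduct ⊥) ∧ EdgeDisjoint F ∧
      ∀ s t, T.Adj s t → Q F s t := by
  classical
  choose g hg using h
  -- an orientation of the edges of `T`
  let r : V → V → Prop := WellOrderingRel
  let col : V → V → W → W → Option C := fun s t a b =>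
    if h : T.Adj s t then if r s t then g s t h a b else g t s h.symm b a else none
  have hcol : ∀ s t a b, T.Adj s t → col s t a b = col t s b a := by
    intro s t a b h
    rcases trichotomous_of r s t with h1 | h1 | h1
    · simp [col, h, h.symm, h1, asymm_of r h1]
    · exact absurd h1 h.ne
    · simp [col, h, h.symm, h1, asymm_of r h1]
  let F : C → SimpleGraph (V × W) := fun x =>
    { Adj := fun P R => T.Adj P.1 R.1 ∧ col P.1 R.1 P.2 R.2 = some x
      symm := ⟨fun P R h => ⟨h.1.symm, by rw [← hcol _ _ _ _ h.1]; exact h.2⟩⟩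
      loopless := ⟨fun P h => h.1.ne rfl⟩ }
  have hF : ∀ s t, T.Adj s t → r s t → Q F s t := by
    intro s t h hr
    refine hg s t h F fun x a b hx => ⟨h, ?_⟩
    simpa [col, h, hr] using hx
  refine ⟨F, fun x P R h => Or.inl h.1, fun x y P R h h' => ?_, fun s t h => ?_⟩
  · exact Option.some_injective _ (h.2.symm.trans h'.2)
  · rcases trichotomous_of r s t with h1 | h1 | h1
    · exact hF s t h h1
    · exact absurd h1 h.ne
    · exact hQ _ _ _ (hF t s h.symm h1)

/-- `F x`, enlarged by a copy of `A i` in every layer if `x` is the index `i` of one of the graphs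
`A i`. -/
def layered (A : ι → SimpleGraph W) (F : W ⊕ ι → SimpleGraph (V × W)) :
    W ⊕ ι → SimpleGraph (V × W)
  | Sum.inl j => F (Sum.inl j)
  | Sum.inr i => F (Sum.inr i) ⊔ lexProduct ⊥ (A i)

lemma le_layered (A : ι → SimpleGraph W) (F : W ⊕ ι → SimpleGraph (V × W)) (x : W ⊕ ι) :
    F x ≤ layered A F x := by
  cases x
  · exact le_rfl
  · exact le_sup_left

lemma Reachable.lexProduct_bot {A : SimpleGraph W} (s : V) {a b : W} (h : A.Reachable a b) :
    (lexProduct (⊥ : SimpleGraph V) A).Reachable (s, a) (s, b) :=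
  h.map (⟨fun a => (s, a), fun h => Or.inr ⟨rfl, h⟩⟩ : A →g lexProduct (⊥ : SimpleGraph V) A)

lemma Reachable.layered {A : ι → SimpleGraph W} (F : W ⊕ ι → SimpleGraph (V × W)) (s : V) {i : ι}
    {a b : W} (h : (A i).Reachable a b) : (layered A F (Sum.inr i)).Reachable (s, a) (s, b) :=
  (h.lexProduct_bot s).mono le_sup_right

/-- Between the layers of `s` and `t`, the walks `(s, p), (t, j), (s, π j), (t, q)` for `j : W`
(a single edge if `j = q`) are edge-disjoint, and leave the edges `(s, c) (t, β i)` free, by which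
the copies of `A i` can be connected. -/
lemma LinkData.exists_colouring_transfer [Nontrivial W] {A : ι → SimpleGraph W} {R : Set W}
    (hA : LinkData A R) {p q : W} (hp : p ∈ R) (hq : q ∈ R) (s t : V) :
    Colourable (fun F s t => ∀ x, (layered A F x).Reachable (s, p) (t, q)) s t := by
  classical
  obtain ⟨β, hβ, hreach, hβq, hπ⟩ := hA.exists_attach q hq
  obtain ⟨c, hcp, hcR⟩ : ∃ c, c ≠ p ∧ (Nonempty ι → c ∈ R) := by
    by_cases h : Nonempty ι
    · obtain ⟨c, hc, hcp, -⟩ := hA.exists_third h p p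
      exact ⟨c, hcp, fun _ => hc⟩
    · obtain ⟨c, hc⟩ := exists_ne p
      exact ⟨c, hc, fun h' => absurd h' h⟩
  obtain ⟨π, hπq, hπc⟩ := hπ p c hcp
  refine ⟨fun a b => if a = p then some (Sum.inl b) else if b = q then some (Sum.inl (π.symm a))
    else if a = π b then some (Sum.inl b) else (Function.partialInv β b).map Sum.inr, ?_⟩
  intro F hF x
  rcases x with j | i
  · by_cases hj : j = q
    · exact (hF (Sum.inl j) p q (by simp [hj])).reachable
    · have hjp : π j ≠ p := fun h => hj (π.injective (h.trans hπq.symm))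
      have h1 := (hF (Sum.inl j) p j (by simp)).reachable
      have h2 := (hF (Sum.inl j) (π j) j (by simp [hj, hjp])).reachable
      have h3 := (hF (Sum.inl j) (π j) q (by simp [hjp])).reachable
      exact (h1.trans h2.symm).trans h3
  · have h1 := (hF (Sum.inr i) c (β i) (by
      simp [hcp, hβq, (hπc i).symm, Function.partialInv_left hβ])).reachable
    have h2 := (hA.links i p hp c (hcR ⟨i⟩)).layered F s
    exact (h2.trans (h1.mono (le_layered _ _ _))).trans ((hreach i).symm.layered F t)

/-- Between the layers of `s` and `t`, the stars with centre `(t, j)` and leaves `(s, a)`, `a ∈ P`,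
are edge-disjoint, and leave the edges `(s, c) (t, β i)` with `c ∉ P` free. -/
lemma LinkData.exists_colouring_star {A : ι → SimpleGraph W} {R : Set W}
    (hA : LinkData A R) {P : Set W} (hP : Nonempty ι → ∃ c ∈ R, c ∉ P)
    {q : W} (hq : q ∈ R) (s t : V) :
    Colourable (fun F s t => (∀ j, ∀ p ∈ P, (layered A F (Sum.inl j)).Reachable (s, p) (t, j)) ∧
      ∀ i, ∀ p ∈ R, (layered A F (Sum.inr i)).Reachable (s, p) (t, q)) s t := by
  classical
  obtain ⟨β, hβ, hreach, -, -⟩ := hA.exists_attach q hq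
  refine ⟨fun a b => if a ∈ P then some (Sum.inl b) else (Function.partialInv β b).map Sum.inr, ?_⟩
  intro F hF
  refine ⟨fun j p hp => (hF (Sum.inl j) p j (by simp [hp])).reachable, fun i p hp => ?_⟩
  obtain ⟨c, hc, hcP⟩ := hP ⟨i⟩
  have h1 := (hF (Sum.inr i) c (β i) (by
      simp [hcP, Function.partialInv_left hβ])).reachable
  have h2 := (hA.links i p hp c hc).layered F s
  exact (h2.trans (h1.mono (le_layered _ _ _))).trans ((hreach i).symm.layered F t)

/-! ### Linking three vertices of the product along one tree of the first factor -/

/-- The edges that `T` contributes to the lexicographic product can be distributed among graphs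
`F x` such that each of the `|W|` graphs `F (inl j)`, and each `F (inr i)` together with the copies
of `A i`, links `S`. -/
def PacksAlong (T : SimpleGraph V) (A : ι → SimpleGraph W) (S : Set (V × W)) : Prop :=
  ∃ F : W ⊕ ι → SimpleGraph (V × W), (∀ x, F x ≤ T.lexProduct ⊥) ∧ EdgeDisjoint F ∧
    ∀ x, (layered A F x).Links S

/-- A vertex to which every element of `S` is connected certifies that `S` is linked. -/
lemma links_of_forall_reachable {K : SimpleGraph V} {S : Set V} (z : V)
    (h : ∀ x ∈ S, K.Reachable z x) : K.Links S :=
  fun x hx y hy => (h x hx).symm.trans (h y hy)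

lemma Reachable.of_forall_adj {T : SimpleGraph V} {K : SimpleGraph (V × W)} {f : V → W}
    (h : ∀ s t, T.Adj s t → K.Reachable (s, f s) (t, f t)) {s t : V} (hst : T.Reachable s t) :
    K.Reachable (s, f s) (t, f t) := by
  obtain ⟨p⟩ := hst
  induction p with
  | nil => rfl
  | cons h' _ ih => exact (h _ _ h').trans ih

/-- Vertices in different layers: they are of the form `(s, p s)`. -/
lemma LinkData.packsAlong_section [Nontrivial W] {A : ι → SimpleGraph W} {R : Set W}
    (hA : LinkData A R) {T : SimpleGraph V} {U : Set V} (hT : T.Links U) (p : V → W)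
    (hp : ∀ s, p s ∈ R) : PacksAlong T A ((fun s => (s, p s)) '' U) := by
  obtain ⟨F, hF, hd, hQ⟩ := exists_edgeDisjoint_of_colourable T
    (Q := fun F s t => ∀ x, (layered A F x).Reachable (s, p s) (t, p t))
    (fun F s t h x => (h x).symm) fun s t _ => by
      obtain ⟨g, hg⟩ := hA.exists_colouring_transfer (hp s) (hp t) s t
      exact ⟨g, hg⟩
  refine ⟨F, hF, hd, fun x => ?_⟩
  rintro _ ⟨s, hs, rfl⟩ _ ⟨t, ht, rfl⟩
  exact Reachable.of_forall_adj (fun s t h => hQ s t h x) (hT s hs t ht)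

/-- Vertices in one layer: each neighbour `(t, j)` is the centre of a star. -/
lemma LinkData.packsAlong_layer {A : ι → SimpleGraph W} {R : Set W}
    (hA : LinkData A R) {T : SimpleGraph V} {u w : V} (huw : T.Adj u w) :
    PacksAlong T A (Prod.mk u '' R) := by
  classical
  obtain ⟨F, hF, hd, hQ⟩ := exists_edgeDisjoint_of_colourable (C := W ⊕ ι) (W := W) T
    (Q := fun F s t => (s = u → ∀ j a, (F (Sum.inl j)).Adj (s, a) (t, j)) ∧
      (t = u → ∀ j a, (F (Sum.inl j)).Adj (t, a) (s, j)))
    (fun F s t h => h.symm) fun s t hst => by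
      refine ⟨fun a b => if s = u then some (Sum.inl b) else some (Sum.inl a),
        fun F hF => ⟨fun h j a => hF _ _ _ (by simp [h]), fun h j a => (hF _ _ _ ?_).symm⟩⟩
      have : s ≠ u := fun h' => hst.ne (h'.trans h.symm)
      simp [this]
  refine ⟨F, hF, hd, fun x => ?_⟩
  rintro _ ⟨a, ha, rfl⟩ _ ⟨b, hb, rfl⟩
  rcases x with j | i
  · have h := (hQ u w huw).1 rfl j
    exact (h a).reachable.trans (h b).symm.reachable
  · exact (hA.links i a ha b hb).layered F u

/-- Two vertices in the layer of `u` and one in that of `w`, where `u` has a `T`-neighbour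
`t ≠ w`: both vertices in the layer of `u` are joined to all `(t, j)`. -/
lemma LinkData.packsAlong_of_adj_left [Nontrivial W] {A : ι → SimpleGraph W} {R : Set W}
    (hA : LinkData A R) {T : SimpleGraph V} {u w t₀ : V} (huw : u ≠ w) (htw : t₀ ≠ w)
    (hut : T.Adj u t₀) (hT : T.Reachable u w) {v₁ v₂ v₃ : W} (h₁ : v₁ ∈ R) (h₂ : v₂ ∈ R)
    (h₃ : v₃ ∈ R) : PacksAlong T A {(u, v₁), (u, v₂), (w, v₃)} := by
  classical
  let p : V → W := fun s => if s = w then v₃ else v₁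
  have hp : ∀ s, p s ∈ R := fun s => by by_cases h : s = w <;> simp [p, h, h₁, h₃]
  -- The vertices that represent the layers of `T` in the graph with index `x`.
  let f : W ⊕ ι → V → W := fun x s => if s = t₀ then x.elim id (fun _ => p t₀) else p s
  have hf : ∀ x s, s ≠ t₀ → f x s = p s := fun x s hs => by simp [f, hs]
  let Q : (W ⊕ ι → SimpleGraph (V × W)) → V → V → Prop := fun F s t =>
    (∀ x, (layered A F x).Reachable (s, f x s) (t, f x t)) ∧
    (s = u → t = t₀ → ∀ j, (layered A F (Sum.inl j)).Reachable (s, v₂) (t, j)) ∧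
    (t = u → s = t₀ → ∀ j, (layered A F (Sum.inl j)).Reachable (t, v₂) (s, j))
  have hQ : ∀ F s t, Q F s t → Q F t s :=
    fun F s t h => ⟨fun x => (h.1 x).symm, h.2.2, h.2.1⟩
  have hstar : ∀ s, s ≠ t₀ → Colourable Q s t₀ := by
    intro s hs
    obtain ⟨g, hg⟩ := hA.exists_colouring_star (P := {p s, if s = u then v₂ else p s})
      (fun h => by
        obtain ⟨c, hc, h1, h2⟩ := hA.exists_third h (p s) (if s = u then v₂ else p s)
        exact ⟨c, hc, by simp only [Set.mem_insert_iff, Set.mem_singleton_iff]; tauto⟩)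
      (hp t₀) s t₀
    refine ⟨g, fun F hF => ?_⟩
    obtain ⟨h1, h2⟩ := hg F hF
    refine ⟨?_, fun h _ j => h1 j v₂ (by simp [h]), fun h _ => absurd h.symm hut.ne⟩
    rintro (j | i)
    · rw [hf _ s hs]
      simpa [f] using h1 j (p s) (by simp)
    · rw [hf _ s hs]
      simpa [f] using h2 i (p s) (hp s)
  obtain ⟨F, hF, hd, hFQ⟩ := exists_edgeDisjoint_of_colourable T hQ fun s t hst => by
    by_cases ht : t = t₀
    · subst ht; exact hstar s hst.ne
    · by_cases hs : s = t₀
      · subst hs; exact (hstar t ht).symm hQ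
      · obtain ⟨g, hg⟩ := hA.exists_colouring_transfer (hp s) (hp t) s t
        refine ⟨g, fun F hF => ⟨fun x => ?_, fun _ h => absurd h ht, fun _ h => absurd h hs⟩⟩
        rw [hf x s hs, hf x t ht]
        exact hg F hF x
  refine ⟨F, hF, hd, fun x => ?_⟩
  have key : ∀ t, T.Reachable u t → (layered A F x).Reachable (u, f x u) (t, f x t) :=
    fun t => Reachable.of_forall_adj fun s t h => (hFQ s t h).1 x
  have hu : f x u = v₁ := by rw [hf x u hut.ne]; simp [p, huw]
  have hw : f x w = v₃ := by rw [hf x w htw.symm]; simp [p]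
  rw [hu] at key
  apply links_of_forall_reachable (u, v₁)
  rintro _ (rfl | rfl | rfl)
  · rfl
  · rcases x with j | i
    · have h1 := key t₀ hut.reachable
      simp only [f, if_true, Sum.elim_inl, id] at h1
      exact h1.trans ((hFQ u t₀ hut).2.1 rfl rfl j).symm
    · exact (hA.links i v₁ h₁ v₂ h₂).layered F u
  · rw [← hw]
    exact key w hT

/-- Two vertices `x = (u, v₁)`, `y = (u, v₂)` in the layer of `u` and one, `z = (w, v₃)`, in that of
`w`, where `u w` and `w t` are edges. For most `j`, the vertices `x`, `y` are joined to `(w, j)`, and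
`z` by the walk `(w, j), (u, π j), z`. This fails for the two indices `j` with `π j = v₁` and
`π j = v₂`, whose graphs contain the edges `x z` and `y z`: here the third vertex is connected via the
layer of `t`. -/
lemma LinkData.packsAlong_of_adj_right [Nontrivial W] {A : ι → SimpleGraph W} {R : Set W}
    (hA : LinkData A R) {T : SimpleGraph V} {u w t₀ : V} (huw : T.Adj u w) (htu : t₀ ≠ u)
    (hwt : T.Adj w t₀) {v₁ v₂ v₃ : W} (h₁ : v₁ ∈ R) (h₂ : v₂ ∈ R)
    (h₃ : v₃ ∈ R) (hv : v₁ ≠ v₂) : PacksAlong T A {(u, v₁), (u, v₂), (w, v₃)} := by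
  classical
  obtain ⟨β, hβ, hreach, hβq, hπ⟩ := hA.exists_attach v₃ h₃
  obtain ⟨c, hc₁, hcR⟩ : ∃ c, c ≠ v₁ ∧ (Nonempty ι → c ∈ R ∧ c ≠ v₂) := by
    by_cases h : Nonempty ι
    · obtain ⟨c, hc, hc₁, hc₂⟩ := hA.exists_third h v₁ v₂
      exact ⟨c, hc₁, fun _ => ⟨hc, hc₂⟩⟩
    · exact ⟨v₂, hv.symm, fun h' => absurd h' h⟩
  obtain ⟨π, hπq, hπc⟩ := hπ v₁ c hc₁
  set j₀ := π.symm v₂ with hj₀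
  have hπj₀ : π j₀ = v₂ := by simp [hj₀]
  have hj₀q : j₀ ≠ v₃ := fun h => hv (by rw [← hπq, ← h, hπj₀])
  let g : W → W → Option (W ⊕ ι) := fun a b =>
    if a = v₁ then some (Sum.inl b)
    else if a = v₂ then
      if b = v₃ then some (Sum.inl j₀) else if b = j₀ then some (Sum.inl v₃) else some (Sum.inl b)
    else if b = v₃ then some (Sum.inl (π.symm a))
    else if a = π b then some (Sum.inl b)
    else (Function.partialInv β b).map Sum.inr
  let Q₁ : (W ⊕ ι → SimpleGraph (V × W)) → V → V → Prop := fun F s t =>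
    s = u → t = w → ∀ x a b, g a b = some x → (F x).Adj (s, a) (t, b)
  let Q₂ : (W ⊕ ι → SimpleGraph (V × W)) → V → V → Prop := fun F s t =>
    s = w → t = t₀ → ∀ j b, (F (Sum.inl j)).Adj (s, b) (t, j)
  obtain ⟨F, hF, hd, hQ⟩ := exists_edgeDisjoint_of_colourable T
    (Q := fun F s t => (Q₁ F s t ∧ Q₁ F t s) ∧ (Q₂ F s t ∧ Q₂ F t s))
    (fun F s t h => ⟨h.1.symm, h.2.symm⟩) fun s t hst => by
      refine ⟨fun a b => if s = u ∧ t = w then g a b else if t = u ∧ s = w then g b a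
        else if s = w then some (Sum.inl b) else some (Sum.inl a), fun F hF => ?_⟩
      refine ⟨⟨?_, ?_⟩, ?_, ?_⟩
      · rintro rfl rfl x a b h
        exact hF x a b (by simpa using h)
      · rintro rfl rfl x a b h
        exact (hF x b a (by simpa [hst.ne] using h)).symm
      · rintro rfl rfl j b
        exact hF _ b j (by simp [htu, hst.ne'])
      · rintro rfl rfl j b
        exact (hF _ j b (by simp [htu, hwt.ne'])).symm
  refine ⟨F, hF, hd, fun x => ?_⟩
  have hg := (hQ u w huw).1.1 rfl rfl
  have ht := (hQ w t₀ hwt).2.1 rfl rfl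
  rcases x with j | i
  · by_cases hj : j = v₃
    · -- the edge `x z` and the walk `y, (w, j₀), (t₀, v₃), z`
      subst hj
      have e1 := (hg (Sum.inl j) v₁ j (by simp [g])).reachable
      have e2 := (hg (Sum.inl j) v₂ j₀ (by simp [g, hv.symm, hj₀q])).reachable
      have e3 := (ht j j₀).reachable
      have e4 := (ht j j).reachable
      apply links_of_forall_reachable (w, j)
      rintro _ (rfl | rfl | rfl)
      · exact e1.symm
      · exact (e4.trans e3.symm).trans e2.symm
      · rfl
    by_cases hj' : j = j₀
    · -- the edge `y z` and the walk `x, (w, j₀), (t₀, j₀), z`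
      subst hj'
      have e1 := (hg (Sum.inl j₀) v₁ j₀ (by simp [g])).reachable
      have e2 := (hg (Sum.inl j₀) v₂ v₃ (by simp [g, hv.symm])).reachable
      have e3 := (ht j₀ j₀).reachable
      have e4 := (ht j₀ v₃).reachable
      apply links_of_forall_reachable (w, v₃)
      rintro _ (rfl | rfl | rfl)
      · exact (e4.trans e3.symm).trans e1.symm
      · exact e2.symm
      · rfl
    have hπ₁ : π j ≠ v₁ := fun h => hj (π.injective (h.trans hπq.symm))
    have hπ₂ : π j ≠ v₂ := fun h => hj' (π.injective (h.trans hπj₀.symm))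
    have e1 := (hg (Sum.inl j) v₁ j (by simp [g])).reachable
    have e2 := (hg (Sum.inl j) v₂ j (by simp [g, hv.symm, hj, hj'])).reachable
    have e3 := (hg (Sum.inl j) (π j) j (by simp [g, hπ₁, hπ₂, hj])).reachable
    have e4 := (hg (Sum.inl j) (π j) v₃ (by simp [g, hπ₁, hπ₂])).reachable
    apply links_of_forall_reachable (w, j)
    rintro _ (rfl | rfl | rfl)
    · exact e1.symm
    · exact e2.symm
    · exact e3.symm.trans e4
  · obtain ⟨hc, hc₂⟩ := hcR ⟨i⟩
    have e := (hg (Sum.inr i) c (β i) (by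
      simp [g, hc₁, hc₂, hβq, (hπc i).symm, Function.partialInv_left hβ])).reachable
    apply links_of_forall_reachable (u, c)
    rintro _ (rfl | rfl | rfl)
    · exact (hA.links i c hc v₁ h₁).layered F u
    · exact (hA.links i c hc v₂ h₂).layered F u
    · exact (e.mono (le_layered _ _ _)).trans ((hreach i).symm.layered F w)

/-- Exactly two of the three vertices lie in one layer. -/
lemma LinkData.packsAlong_two_layers [Nontrivial W] {A : ι → SimpleGraph W} {R : Set W}
    (hA : LinkData A R) {T : SimpleGraph V} {U : Set V} (hT : T.Links U) {u w r : V}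
    (hu : u ∈ U) (hw : w ∈ U) (hr : r ∈ U) (huw : u ≠ w) (hru : r ≠ u) (hrw : r ≠ w)
    {v₁ v₂ v₃ : W} (h₁ : v₁ ∈ R) (h₂ : v₂ ∈ R) (h₃ : v₃ ∈ R) (hv : v₁ ≠ v₂) :
    PacksAlong T A {(u, v₁), (u, v₂), (w, v₃)} := by
  by_cases h : ∃ t, T.Adj u t ∧ t ≠ w
  · obtain ⟨t, hut, htw⟩ := h
    exact hA.packsAlong_of_adj_left huw htw hut (hT u hu w hw) h₁ h₂ h₃
  · push Not at h
    obtain ⟨t, hut⟩ := hT.exists_adj hu hw huw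
    obtain rfl := h t hut
    obtain ⟨a, ha, b, hb, hab⟩ := (hT u hu r hr).exists_adj_boundary {u, t} (by simp)
      (by simp [hru, hrw])
    simp only [Set.mem_insert_iff, Set.mem_singleton_iff, not_or] at ha hb
    rcases ha with rfl | rfl
    · exact absurd (h b hab) hb.2
    · exact hA.packsAlong_of_adj_right hut hb.1 hab h₁ h₂ h₃ hv

lemma PacksAlong.mono {T : SimpleGraph V} {A : ι → SimpleGraph W} {S S' : Set (V × W)}
    (h : PacksAlong T A S) (hS : S' ⊆ S) : PacksAlong T A S' := by
  obtain ⟨F, hF, hd, hl⟩ := h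
  exact ⟨F, hF, hd, fun x P hP Q hQ => hl x P (hS hP) Q (hS hQ)⟩

lemma LinkData.packsAlong [Nontrivial W] {A : ι → SimpleGraph W} {R : Set W}
    (hA : LinkData A R) {T : SimpleGraph V} {U : Finset V} (hU : U.card = 3)
    (hT : T.Links (U : Set V)) {S : Finset (V × W)} (hS : S.card = 3)
    (hSU : ∀ P ∈ S, P.1 ∈ U) (hSR : ∀ P ∈ S, P.2 ∈ R) : PacksAlong T A (S : Set (V × W)) := by
  classical
  -- a third element of `U`
  have third : ∀ u w, ∃ r ∈ U, r ≠ u ∧ r ≠ w := by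
    intro u w
    obtain ⟨c, hc, hc'⟩ := Finset.exists_mem_notMem_of_card_lt_card
      (s := {u, w}) (t := U) (by have := Finset.card_le_two (a := u) (b := w); omega)
    simp only [Finset.mem_insert, Finset.mem_singleton, not_or] at hc'
    exact ⟨c, hc, hc'⟩
  have two : ∀ {P Q Z : V × W}, P ∈ S → Q ∈ S → Z ∈ S → P ≠ Q → P.1 = Q.1 → P.1 ≠ Z.1 →
      PacksAlong T A {P, Q, Z} := by
    rintro ⟨u, v₁⟩ ⟨u', v₂⟩ ⟨w, v₃⟩ hP hQ hZ hPQ h huw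
    obtain rfl : u = u' := h
    obtain ⟨r, hr, hru, hrw⟩ := third u w
    exact hA.packsAlong_two_layers hT (hSU _ hP) (hSU _ hZ) hr huw hru hrw (hSR _ hP) (hSR _ hQ)
      (hSR _ hZ) fun h => hPQ (by rw [h])
  obtain ⟨P, Q, Z, hPQ, hPZ, hQZ, rfl⟩ := Finset.card_eq_three.1 hS
  have hP : P ∈ ({P, Q, Z} : Finset (V × W)) := by simp
  have hQ : Q ∈ ({P, Q, Z} : Finset (V × W)) := by simp
  have hZ : Z ∈ ({P, Q, Z} : Finset (V × W)) := by simp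
  by_cases h1 : P.1 = Q.1
  · by_cases h2 : P.1 = Z.1
    · obtain ⟨r, hr, hru, -⟩ := third P.1 P.1
      obtain ⟨w, hw⟩ := hT.exists_adj (hSU P hP) hr hru.symm
      refine (hA.packsAlong_layer hw).mono fun X hX => ⟨X.2, hSR X hX, ?_⟩
      simp only [Finset.coe_insert, Finset.coe_singleton, Set.mem_insert_iff,
        Set.mem_singleton_iff] at hX
      rcases hX with rfl | rfl | rfl
      · rfl
      · rw [h1]
      · rw [h2]
    · exact (two hP hQ hZ hPQ h1 h2).mono (by simp)
  · by_cases h2 : P.1 = Z.1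
    · refine (two hP hZ hQ hPZ h2 h1).mono fun X hX => ?_
      simp only [Finset.coe_insert, Finset.coe_singleton, Set.mem_insert_iff,
        Set.mem_singleton_iff] at hX ⊢
      tauto
    · by_cases h3 : Q.1 = Z.1
      · refine (two hQ hZ hP hQZ h3 (Ne.symm h1)).mono fun X hX => ?_
        simp only [Finset.coe_insert, Finset.coe_singleton, Set.mem_insert_iff,
          Set.mem_singleton_iff] at hX ⊢
        tauto
      · let p : V → W := fun s => if s = P.1 then P.2 else if s = Q.1 then Q.2 else Z.2
        refine (hA.packsAlong_section hT p fun s => ?_).mono fun X hX => ⟨X.1, hSU X hX, ?_⟩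
        · simp only [p]
          split_ifs
          exacts [hSR P hP, hSR Q hQ, hSR Z hZ]
        · simp only [Finset.coe_insert, Finset.coe_singleton, Set.mem_insert_iff,
            Set.mem_singleton_iff] at hX
          rcases hX with rfl | rfl | rfl
          · simp [p]
          · simp [p, Ne.symm h1]
          · simp [p, Ne.symm h2, Ne.symm h3]

/-! ### Assembling the packing -/

lemma Connected.lexProduct [Nontrivial V] [Nonempty W] {G : SimpleGraph V} (hG : G.Connected)
    (H : SimpleGraph W) : (G.lexProduct H).Connected := by
  have adj : ∀ {s t : V} (a b : W), G.Adj s t → (G.lexProduct H).Adj (s, a) (t, b) :=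
    fun _ _ h => Or.inl h
  have layer : ∀ (s : V) (a b : W), (G.lexProduct H).Reachable (s, a) (s, b) := by
    intro s a b
    obtain ⟨t, ht⟩ := hG.preconnected.exists_adj_of_nontrivial s
    exact (adj a a ht).reachable.trans (adj a b ht.symm).reachable
  have : ∀ (s t : V) (a : W), G.Reachable s t → (G.lexProduct H).Reachable (s, a) (t, a) := by
    rintro s t a ⟨p⟩
    induction p with
    | nil => rfl
    | cons h _ ih => exact (adj a a h).reachable.trans ih
  rw [connected_iff]
  exact ⟨fun P Q => (this _ _ _ (hG.preconnected P.1 Q.1)).trans (layer _ _ _), inferInstance⟩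

lemma lexProduct_mono {G T : SimpleGraph V} {H A : SimpleGraph W} (hT : T ≤ G) (hA : A ≤ H) :
    T.lexProduct A ≤ G.lexProduct H :=
  fun _ _ h => h.imp (fun h => hT h) fun h => ⟨h.1, hA h.2⟩

lemma lexProduct_bot_right_adj {T : SimpleGraph V} {P Q : V × W} :
    (T.lexProduct (⊥ : SimpleGraph W)).Adj P Q ↔ T.Adj P.1 Q.1 := by
  simp [lexProduct]

lemma lexProduct_bot_left_adj {A : SimpleGraph W} {P Q : V × W} :
    ((⊥ : SimpleGraph V).lexProduct A).Adj P Q ↔ P.1 = Q.1 ∧ A.Adj P.2 Q.2 := by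
  simp [lexProduct]

/-- Edge-disjoint subgraphs of a product with an edgeless second factor stay edge-disjoint when
different copies of the graphs `A i` are added in the layers. -/
lemma EdgeDisjoint.sup_lexProduct {G : SimpleGraph V} {F : C → SimpleGraph (V × W)}
    (hd : EdgeDisjoint F) (hF : ∀ x, F x ≤ G.lexProduct ⊥) {L : C → SimpleGraph W}
    (hL : EdgeDisjoint L) :
    EdgeDisjoint fun x => F x ⊔ lexProduct (⊥ : SimpleGraph V) (L x) := by
  intro x y P Q h h'
  simp only [sup_adj, lexProduct_bot_left_adj] at h h'
  rcases h with h | h <;> rcases h' with h' | h'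
  · exact hd x y P Q h h'
  · exact absurd h'.1 (lexProduct_bot_right_adj.1 (hF x h)).ne
  · exact absurd h.1 (lexProduct_bot_right_adj.1 (hF y h')).ne
  · exact hL x y _ _ h.2 h'.2

lemma hasSteinerPacking_lexProduct [Fintype W] {G : SimpleGraph V} {H : SimpleGraph W}
    {l k : ℕ} {T : Fin l → SimpleGraph V} (hTG : ∀ τ, T τ ≤ G) (hT : EdgeDisjoint T)
    (τ₀ : Fin l) {A : Fin k → SimpleGraph W} (hAH : ∀ i, A i ≤ H) (hA : EdgeDisjoint A)
    {S : Finset (V × W)} (hS : S.Nonempty) (h : ∀ τ, PacksAlong (T τ) A (S : Set (V × W))) :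
    (G.lexProduct H).HasSteinerPacking S (k + l * Fintype.card W) := by
  choose F hFT hF hl using h
  let K : Fin k ⊕ (Fin l × W) → SimpleGraph (V × W) :=
    Sum.elim (fun i => F τ₀ (Sum.inr i)) fun P => F P.1 (Sum.inl P.2)
  let L : Fin k ⊕ (Fin l × W) → SimpleGraph W := Sum.elim A fun _ => ⊥
  have hKT : ∀ {τ τ' x y P Q}, (F τ x).Adj P Q → (F τ' y).Adj P Q → τ = τ' ∧ x = y := by
    intro τ τ' x y P Q h h'
    obtain rfl : τ = τ' := hT τ τ' _ _ (lexProduct_bot_right_adj.1 (hFT τ x h))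
      (lexProduct_bot_right_adj.1 (hFT τ' y h'))
    exact ⟨rfl, hF τ x y P Q h h'⟩
  have hK : EdgeDisjoint K := by
    rintro (i | ⟨τ, j⟩) (i' | ⟨τ', j'⟩) P Q h h'
    · obtain ⟨-, h⟩ := hKT h h'
      rw [Sum.inr_injective h]
    · simpa using (hKT h h').2
    · simpa using (hKT h h').2
    · obtain ⟨rfl, h⟩ := hKT h h'
      obtain rfl : j = j' := Sum.inl_injective h
      rfl
  have hKG : ∀ x, K x ≤ G.lexProduct ⊥ := by
    rintro (i | ⟨τ, j⟩)
    · exact (hFT _ _).trans (lexProduct_mono (hTG _) le_rfl)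
    · exact (hFT _ _).trans (lexProduct_mono (hTG _) le_rfl)
  have hL : EdgeDisjoint L := by
    rintro (i | P) (i' | P') a b h h'
    · rw [hA i i' a b h h']
    · exact absurd h' id
    · exact absurd h id
    · exact absurd h id
  have := hasSteinerPacking_of_edgeDisjoint (G := G.lexProduct H) hS
    (fun x => K x ⊔ lexProduct (⊥ : SimpleGraph V) (L x)) ?_ (hK.sup_lexProduct hKG hL) ?_
  · simpa using this
  · rintro x
    refine sup_le ((hKG x).trans (lexProduct_mono le_rfl bot_le)) (lexProduct_mono bot_le ?_)
    rcases x with i | P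
    · exact hAH i
    · exact bot_le
  · rintro (i | ⟨τ, j⟩)
    · exact hl τ₀ (Sum.inr i)
    · exact (hl τ (Sum.inl j)).mono le_sup_left

/-- If `G` is connected, then copies of the `A i` in all layers are connected by edges
`(s, v) (t, β i)`. -/
lemma LinkData.hasSteinerPacking {G : SimpleGraph V} (hG : G.Connected) {H : SimpleGraph W} {k : ℕ}
    {A : Fin k → SimpleGraph W} {R : Set W} (hA : LinkData A R) (hAH : ∀ i, A i ≤ H)
    {S : Finset (V × W)} (hS : S.Nonempty) (hSR : ∀ P ∈ S, P.2 ∈ R) :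
    (G.lexProduct H).HasSteinerPacking S k := by
  classical
  obtain ⟨⟨u, v⟩, hv⟩ := hS
  have hvR := hSR _ hv
  obtain ⟨β, hβ, hreach, -, -⟩ := hA.exists_attach v hvR
  obtain ⟨F, hF, hd, hQ⟩ := exists_edgeDisjoint_of_colourable (C := Fin k) G
    (Q := fun F s t => ∀ i, (F i ⊔ lexProduct (⊥ : SimpleGraph V) (A i)).Reachable (s, v) (t, v))
    (fun F s t h i => (h i).symm) fun s t _ =>
      ⟨fun a b => if a = v then Function.partialInv β b else none, fun F hF i => by
        have h := (hF i v (β i) (by simp [Function.partialInv_left hβ])).reachable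
        exact (h.mono le_sup_left).trans (((hreach i).symm.lexProduct_bot t).mono le_sup_right)⟩
  have := hasSteinerPacking_of_edgeDisjoint (G := G.lexProduct H) ⟨_, hv⟩
    (fun i => F i ⊔ lexProduct (⊥ : SimpleGraph V) (A i)) ?_
    (hd.sup_lexProduct hF hA.edgeDisjoint) ?_
  · simpa using this
  · intro i
    exact sup_le ((hF i).trans (lexProduct_mono le_rfl bot_le)) (lexProduct_mono bot_le (hAH i))
  · intro i
    apply links_of_forall_reachable (u, v)
    rintro ⟨s, a⟩ ha
    have h : (F i ⊔ lexProduct (⊥ : SimpleGraph V) (A i)).Reachable (u, v) (s, v) :=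
      Reachable.of_forall_adj (f := fun _ => v) (fun s t h => hQ s t h i) (hG.preconnected u s)
    exact h.trans (((hA.links i v hvR a (hSR _ ha)).lexProduct_bot s).mono le_sup_right)

/-- The edge-disjoint trees provided by `λ₃(H)`, for the second coordinates of `S`. -/
lemma exists_linkData [Fintype W] (H : SimpleGraph W) {S : Finset (V × W)} (hS : S.card = 3) :
    ∃ (A : Fin (H.genEdgeConnectivity 3) → SimpleGraph W) (R : Set W),
      (∀ i, A i ≤ H) ∧ LinkData A R ∧ ∀ P ∈ S, P.2 ∈ R := by
  classical
  rcases Nat.eq_zero_or_pos (H.genEdgeConnectivity 3) with h | h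
  · have : IsEmpty (Fin (H.genEdgeConnectivity 3)) := by rw [h]; infer_instance
    exact ⟨fun _ => ⊥, Set.univ, fun _ => bot_le, LinkData.of_isEmpty _ _, fun _ _ => trivial⟩
  · obtain ⟨R, hSR, -, hR⟩ := Finset.exists_subsuperset_card_eq
      (Finset.subset_univ (S.image Prod.snd)) (Finset.card_image_le.trans hS.le)
      (three_le_card_of_genEdgeConnectivity_pos h)
    obtain ⟨A, hAH, hA, hl⟩ :=
      (hasSteinerPacking_genEdgeConnectivity (G := H) hR).exists_edgeDisjoint
    exact ⟨A, R, hAH, LinkData.of_links hA hR hl, fun P hP => hSR (Finset.mem_image_of_mem _ hP)⟩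

lemma add_mul_card_le_genEdgeConnectivity_lexProduct [Fintype V] [Fintype W] [Nontrivial V]
    [Nontrivial W] {G : SimpleGraph V} (H : SimpleGraph W) (hG : G.Connected) :
    H.genEdgeConnectivity 3 + G.genEdgeConnectivity 3 * Fintype.card W ≤
      (G.lexProduct H).genEdgeConnectivity 3 := by
  classical
  have hV := Fintype.one_lt_card (α := V)
  have hW := Fintype.one_lt_card (α := W)
  refine le_genEdgeConnectivity (hG.lexProduct H) (by rw [Fintype.card_prod]; nlinarith)
    fun S hS => ?_
  have hS₀ : S.Nonempty := Finset.card_pos.1 (by omega)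
  obtain ⟨A, R, hAH, hA, hSR⟩ := exists_linkData H hS
  rcases Nat.eq_zero_or_pos (G.genEdgeConnectivity 3) with h | h
  · rw [h, zero_mul, add_zero]
    exact hA.hasSteinerPacking hG hAH hS₀ hSR
  · obtain ⟨U, hSU, -, hU⟩ := Finset.exists_subsuperset_card_eq
      (Finset.subset_univ (S.image Prod.fst)) (Finset.card_image_le.trans hS.le)
      (three_le_card_of_genEdgeConnectivity_pos h)
    obtain ⟨T, hTG, hT, hl⟩ :=
      (hasSteinerPacking_genEdgeConnectivity (G := G) hU).exists_edgeDisjoint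
    exact hasSteinerPacking_lexProduct hTG hT ⟨0, h⟩ hAH hA.edgeDisjoint hS₀ fun τ =>
      hA.packsAlong hU (hl τ) hS (fun P hP => hSU (Finset.mem_image_of_mem _ hP)) hSR

/-! ### Paths -/

lemma genEdgeConnectivity_pathGraph {n : ℕ} (hn : 3 ≤ n) :
    (pathGraph n).genEdgeConnectivity 3 = 1 := by
  obtain ⟨n, rfl⟩ := Nat.exists_eq_add_of_le' hn
  refine le_antisymm ?_ (one_le_genEdgeConnectivity (pathGraph_connected _) (by simp))
  refine (genEdgeConnectivity_le_card (by simp) 0 {1} fun u hu => ?_).trans (by simp)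
  rw [pathGraph_adj] at hu
  simp only [Finset.mem_singleton, Fin.ext_iff]
  simp at hu ⊢
  omega

/-- An end vertex in an end layer has degree `n + 1`. -/
lemma genEdgeConnectivity_lexProduct_pathGraph_le {m n : ℕ} (hm : 3 ≤ m) (hn : 3 ≤ n) :
    ((pathGraph m).lexProduct (pathGraph n)).genEdgeConnectivity 3 ≤ 1 + n := by
  have hc : 3 ≤ Fintype.card (Fin m × Fin n) := by
    simp only [Fintype.card_prod, Fintype.card_fin]; nlinarith
  refine (genEdgeConnectivity_le_card hc (⟨0, by omega⟩, ⟨0, by omega⟩)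
    ({(⟨0, by omega⟩, ⟨1, by omega⟩)} ∪ Finset.univ.image fun j => (⟨1, by omega⟩, j)) ?_).trans ?_
  · rintro ⟨s, a⟩ (h | ⟨h, h'⟩)
    · rw [pathGraph_adj] at h
      have : s = ⟨1, by omega⟩ := Fin.ext (by simp only at h ⊢; omega)
      simp [this]
    · rw [pathGraph_adj] at h'
      have : a = ⟨1, by omega⟩ := Fin.ext (by simp only at h' ⊢; omega)
      simp only at h
      simp [this, ← h]
  · refine (Finset.card_union_le _ _).trans ?_
    gcongr
    · simp
    · exact Finset.card_image_le.trans (by simp)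

end SimpleGraph

theorem theorem1 :
    (∀ (V W : Type*) [Fintype V] [Fintype W] [Nontrivial V] [Nontrivial W]
      (G : SimpleGraph V) (H : SimpleGraph W), G.Connected →
      H.genEdgeConnectivity 3 + G.genEdgeConnectivity 3 * Fintype.card W ≤
        (G.lexProduct H).genEdgeConnectivity 3) ∧
    (∀ m n : ℕ, 3 ≤ m → 3 ≤ n →
      ((SimpleGraph.pathGraph m).lexProduct (SimpleGraph.pathGraph n)).genEdgeConnectivity 3 =
        (SimpleGraph.pathGraph n).genEdgeConnectivity 3 +
          (SimpleGraph.pathGraph m).genEdgeConnectivity 3 * n) := by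
  refine ⟨fun V W _ _ _ _ G H hG =>
    SimpleGraph.add_mul_card_le_genEdgeConnectivity_lexProduct H hG,
    fun m n hm hn => le_antisymm ?_ ?_⟩
  · rw [SimpleGraph.genEdgeConnectivity_pathGraph hm, SimpleGraph.genEdgeConnectivity_pathGraph hn,
      one_mul]
    exact SimpleGraph.genEdgeConnectivity_lexProduct_pathGraph_le hm hn
  · obtain ⟨m, rfl⟩ := Nat.exists_eq_add_of_le' hm
    obtain ⟨n, rfl⟩ := Nat.exists_eq_add_of_le' hn
    simpa using SimpleGraph.add_mul_card_le_genEdgeConnectivity_lexProduct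
      (SimpleGraph.pathGraph (n + 3)) (SimpleGraph.pathGraph_connected (m + 2))
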